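/- Let $G$ be a transitive permutation group on a nonempty finite set $\Omega$, $n=|\Omega|$. Elements of $\mathbb{C}\Omega$ are regarded as row vectors, $*$ denotes conjugate transpose, and $v^g$ is the image of $v$ under the coordinate-permuting action of $g$. A homogeneous coherent configuration on $\Omega$ is a set $\mathcal{R}$ of nonempty relations partitioning $\Omega\times\Omega$, containing the identity relation, closed under taking converses, and such that for $R,S,T\in\mathcal{R}$ and $(x,y)\in T$ the number $p_{RS}^T$ of $z\in\Omega$ with $(x,z)\in R$ and $(z,y)\in S$ does not depend on the choice of $(x,y)\in T$. It is commutative if $p_{RS}^T=p_{SR}^T$ for all $R,S,T$; a commutative homogeneous coherent configuration is called an association scheme. Let $\mathcal{K}(G)$ be the homogeneous coherent configuration on $\Omega$ formed by the orbitals of $G$, that is, the orbits of $G$ on $\Omega\times\Omega$. Its symmetrisation $\mathcal{K}(G)^{\mathrm{Sym}}$ is the set of relations obtained by replacing each relation by its union with its converse; $\mathcal{K}(G)$ is stratifiable if $\mathcal{K}(G)^{\mathrm{Sym}}$ is an association scheme. The adjacency algebra of a homogeneous coherent configuration is the subalgebra of the complex $\Omega\times\Omega$ matrices generated by the adjacency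 matrices of its relations. Vectors $u,v\in\mathbb{C}\Omega$ are design-orthogonal in the configuration if $(u\Pi u^*)(v\Pi v^*)=0$ for every central primitive idempotent $\Pi$ of its adjacency algebra other than the principal idempotent $\frac1n J$, where $J$ is the all-ones matrix. **Proposition.** Let $u,v\in\mathbb{C}\Omega$ satisfy $u(v^g)^*=uv^*$ for all $g\in G$. (a) If $\mathcal{K}(G)$ is commutative, then $u$ and $v$ are design-orthogonal in $\mathcal{K}(G)$. (b) If $\mathcal{K}(G)$ is stratifiable and $u,v\in\mathbb{R}\Omega$, then $u$ and $v$ are design-orthogonal in both $\mathcal{K}(G)$ and $\mathcal{K}(G)^{\mathrm{Sym}}$. -/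

import Mathlib

open scoped Matrix

namespace CoherentConfig

variable {Ω : Type*}

/-- The converse relation `Rᵀ = {(x, y) : (y, x) ∈ R}`. -/
def converse (R : Set (Ω × Ω)) : Set (Ω × Ω) := {p | (p.2, p.1) ∈ R}

/-- The number of `z` with `(x, z) ∈ R` and `(z, y) ∈ S`. When `R`, `S`, `T` are relations of a
coherent configuration and `(x, y) ∈ T`, this is the intersection number of `R`, `S`, `T`. -/
noncomputable def pathCount (R S : Set (Ω × Ω)) (x y : Ω) : ℕ :=
  {z : Ω | (x, z) ∈ R ∧ (z, y) ∈ S}.ncard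

/-- A set `𝓡` of binary relations on `Ω` is a homogeneous coherent configuration. -/
structure IsHomogeneous (𝓡 : Set (Set (Ω × Ω))) : Prop where
  diagonal_mem : Set.diagonal Ω ∈ 𝓡
  /-- the members are nonempty and partition `Ω × Ω` -/
  isPartition : Setoid.IsPartition 𝓡
  converse_mem : ∀ R ∈ 𝓡, converse R ∈ 𝓡
  pathCount_eq : ∀ R ∈ 𝓡, ∀ S ∈ 𝓡, ∀ T ∈ 𝓡, ∀ p ∈ T, ∀ q ∈ T,
    pathCount R S p.1 p.2 = pathCount R S q.1 q.2

/-- Commutativity: the intersection numbers are symmetric in their first two arguments. -/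
def IsCommutative (𝓡 : Set (Set (Ω × Ω))) : Prop :=
  ∀ R ∈ 𝓡, ∀ S ∈ 𝓡, ∀ x y : Ω, pathCount R S x y = pathCount S R x y

/-- An association scheme is a commutative homogeneous coherent configuration. -/
def IsAssociationScheme (𝓡 : Set (Set (Ω × Ω))) : Prop :=
  IsHomogeneous 𝓡 ∧ IsCommutative 𝓡

/-- The symmetrisation: every relation is replaced by its union with its converse (so symmetric
relations are kept, and pairs of converse nonsymmetric relations are merged). -/
def symmetrisation (𝓡 : Set (Set (Ω × Ω))) : Set (Set (Ω × Ω)) :=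
  (fun R => R ∪ converse R) '' 𝓡

/-- `𝓡` is stratifiable if its symmetrisation is an association scheme. -/
def IsStratifiable (𝓡 : Set (Set (Ω × Ω))) : Prop :=
  IsAssociationScheme (symmetrisation 𝓡)

/-- `𝓚(G)`: the set of orbitals of `G`, i.e. the orbits of `G` on ordered pairs. -/
def orbitals (G : Type*) [Group G] (Ω : Type*) [MulAction G Ω] : Set (Set (Ω × Ω)) :=
  Set.range fun p : Ω × Ω => MulAction.orbit G p

/-- The adjacency matrix of a relation. -/
noncomputable def adjMatrix (R : Set (Ω × Ω)) : Matrix Ω Ω ℂ :=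
  Matrix.of fun x y => R.indicator (fun _ => (1 : ℂ)) (x, y)

/-- The adjacency algebra over `ℂ`, generated by the adjacency matrices. -/
noncomputable def adjacencyAlgebra [Fintype Ω] [DecidableEq Ω] (𝓡 : Set (Set (Ω × Ω))) :
    Subalgebra ℂ (Matrix Ω Ω ℂ) :=
  Algebra.adjoin ℂ (adjMatrix '' 𝓡)

/-- A central primitive idempotent of a ring: a nonzero central idempotent that has no central
idempotents below it other than `0` and itself. -/
structure IsCentralPrimitiveIdempotent {A : Type*} [Ring A] (e : A) : Prop where
  isIdempotentElem : IsIdempotentElem e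
  mem_center : e ∈ Subring.center A
  ne_zero : e ≠ 0
  primitive : ∀ f : A, IsIdempotentElem f → f ∈ Subring.center A → f * e = f → f = 0 ∨ f = e

/-- The principal idempotent `(1/n) J`, where `n = |Ω|` and `J` is the all-ones matrix. -/
noncomputable def principalIdempotent (Ω : Type*) [Fintype Ω] : Matrix Ω Ω ℂ :=
  Matrix.of fun _ _ => (Fintype.card Ω : ℂ)⁻¹

/-- The value `u M u*` for a row vector `u`. -/
noncomputable def quadForm [Fintype Ω] (M : Matrix Ω Ω ℂ) (u : Ω → ℂ) : ℂ :=
  (u ᵥ* M) ⬝ᵥ star u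

/-- `u` and `v` are design-orthogonal in `𝓡`: `(u Π u*) (v Π v*) = 0` for every nonprincipal
central primitive idempotent `Π` of the adjacency algebra. -/
def DesignOrthogonal [Fintype Ω] [DecidableEq Ω] (𝓡 : Set (Set (Ω × Ω))) (u v : Ω → ℂ) : Prop :=
  ∀ e : adjacencyAlgebra 𝓡, IsCentralPrimitiveIdempotent e →
    (e : Matrix Ω Ω ℂ) ≠ principalIdempotent Ω →
      quadForm (e : Matrix Ω Ω ℂ) u * quadForm (e : Matrix Ω Ω ℂ) v = 0

/-- The image `v^g` of the vector `v` under the action of `g` permuting coordinates. -/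
def permute {G : Type*} [Group G] [MulAction G Ω] (v : Ω → ℂ) (g : G) : Ω → ℂ :=
  fun x => v (g⁻¹ • x)

end CoherentConfig

/-! The averaged matrix `N = ∑ g, (v^g)* v^g` (`orbitGram`) is Hermitian and `G`-invariant. The
hypothesis gives `u N = (u v*) ∑ g, v^g`, a constant vector by transitivity (`vecMul_orbitGram`). In
a commutative algebra containing `N`, `N e = c e` for each primitive idempotent `e`
(`mul_eq_smul_of_isCentralPrimitiveIdempotent`). A nonprincipal `e` kills constant vectors, so `c •
(u e) = u N e = 0`. Either `u e = 0`, or `c = 0` and `0 = tr (N e) = |G| (v e v*)`. This is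
`quadForm_mul_quadForm_eq_zero`; it gives (a), and also the symmetrised half of (b), since `N` is
symmetric for real `v`.

For `𝓚(G)` itself in (b), idempotents of the symmetrised algebra are central in the full algebra
(`mul_comm_of_isStratifiable`). So for a central primitive idempotent `E` of the full algebra,
either `E` is symmetric and is primitive in the symmetrised one, or `E Eᵀ = 0` and `E + Eᵀ` is
primitive there. On real vectors the form of `E + Eᵀ` is twice that of `E`. -/

namespace CoherentConfig

/-! ### Adjacency algebras of partitions and commutativity -/

section Partition

variable {Ω : Type*} [Fintype Ω] [DecidableEq Ω]

/-- A matrix that is constant on the classes of a partition lies in the adjacency algebra. -/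
theorem mem_adjacencyAlgebra_of_const {𝓡 : Set (Set (Ω × Ω))} (h𝓡 : Setoid.IsPartition 𝓡)
    {M : Matrix Ω Ω ℂ} (hM : ∀ R ∈ 𝓡, ∀ p ∈ R, ∀ q ∈ R, M p.1 p.2 = M q.1 q.2) :
    M ∈ adjacencyAlgebra 𝓡 := by
  classical
  have hfin : 𝓡.Finite := Set.toFinite 𝓡
  have hc : ∀ R : Set (Ω × Ω), ∃ c : ℂ, R ∈ 𝓡 → ∀ p ∈ R, M p.1 p.2 = c := by
    intro R
    by_cases hR : R ∈ 𝓡 ∧ R.Nonempty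
    · obtain ⟨hR, q, hq⟩ := hR
      exact ⟨M q.1 q.2, fun _ p hp => hM R hR p hp q hq⟩
    · exact ⟨0, fun h p hp => absurd ⟨h, p, hp⟩ hR⟩
  choose c hc using hc
  have key : M = ∑ R ∈ hfin.toFinset, c R • adjMatrix R := by
    ext x y
    obtain ⟨R, ⟨hR, hxy⟩, huniq⟩ := h𝓡.2 (x, y)
    rw [Matrix.sum_apply, Finset.sum_eq_single R]
    · simp [adjMatrix, hxy, ← hc R hR _ hxy]
    · intro S hS hne
      have : (x, y) ∉ S := fun h => hne (huniq S ⟨by simpa using hS, h⟩)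
      simp [adjMatrix, this]
    · intro h
      exact absurd (by simpa using hR) h
  rw [key]
  refine Subalgebra.sum_mem _ fun R hR => Subalgebra.smul_mem _ ?_ _
  exact Algebra.subset_adjoin ⟨R, by simpa using hR, rfl⟩

theorem adjMatrix_mul_apply {Ω : Type*} [Fintype Ω] (R S : Set (Ω × Ω)) (x y : Ω) :
    (adjMatrix R * adjMatrix S) x y = pathCount R S x y := by
  classical
  have h : {z : Ω | (x, z) ∈ R ∧ (z, y) ∈ S} =
      ((Finset.univ.filter fun z => (x, z) ∈ R ∧ (z, y) ∈ S : Finset Ω) : Set Ω) := by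
    ext; simp
  rw [pathCount, h, Set.ncard_coe_finset, Matrix.mul_apply, Finset.card_filter]
  push_cast
  refine Finset.sum_congr rfl fun z _ => ?_
  by_cases h1 : (x, z) ∈ R <;> by_cases h2 : (z, y) ∈ S <;> simp [adjMatrix, h1, h2]

theorem mul_comm_of_mem_adjacencyAlgebra {𝓡 : Set (Set (Ω × Ω))} (h : IsCommutative 𝓡)
    {M N : Matrix Ω Ω ℂ} (hM : M ∈ adjacencyAlgebra 𝓡) (hN : N ∈ adjacencyAlgebra 𝓡) :
    M * N = N * M := by
  have hcomm : ∀ a ∈ adjMatrix '' 𝓡, ∀ b ∈ adjMatrix '' 𝓡, a * b = b * a := by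
    rintro _ ⟨R, hR, rfl⟩ _ ⟨S, hS, rfl⟩
    ext x y
    rw [adjMatrix_mul_apply, adjMatrix_mul_apply, h R hR S hS]
  have := Algebra.isMulCommutative_adjoin ℂ hcomm
  exact congrArg Subtype.val
    (mul_comm' (⟨M, hM⟩ : Algebra.adjoin ℂ (adjMatrix '' 𝓡)) ⟨N, hN⟩)

/-- The generators are symmetric; transposing a product reverses it, and commutativity restores the
order. -/
theorem transpose_eq_of_mem_symmetrisation {𝓡 : Set (Set (Ω × Ω))}
    (h : IsCommutative (symmetrisation 𝓡)) {M : Matrix Ω Ω ℂ}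
    (hM : M ∈ adjacencyAlgebra (symmetrisation 𝓡)) : Mᵀ = M := by
  induction hM using Algebra.adjoin_induction with
  | mem a ha =>
    obtain ⟨_, ⟨R, -, rfl⟩, rfl⟩ := ha
    ext x y
    by_cases h1 : (x, y) ∈ R <;> by_cases h2 : (y, x) ∈ R <;>
      simp [adjMatrix, converse, Set.indicator, h1, h2]
  | algebraMap r => simp [Algebra.algebraMap_eq_smul_one]
  | add a b _ _ ha hb => rw [Matrix.transpose_add, ha, hb]
  | mul a b ha' hb' ha hb =>
    rw [Matrix.transpose_mul, ha, hb]
    exact mul_comm_of_mem_adjacencyAlgebra h hb' ha'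

end Partition

/-! ### The orbital algebra and its symmetric part -/

section Orbitals

variable {Ω G : Type*} [Fintype Ω] [DecidableEq Ω] [Group G] [MulAction G Ω]

theorem isPartition_orbitals {Ω G : Type*} [Group G] [MulAction G Ω] : Setoid.IsPartition (orbitals G Ω) := by
  have := Setoid.isPartition_classes (MulAction.orbitRel G (Ω × Ω))
  convert this using 1
  ext R
  simp only [orbitals, Set.mem_range, Setoid.classes, Set.mem_ofPred_eq]
  refine exists_congr fun p => ?_
  rw [eq_comm]
  rfl

theorem smul_mem_orbit_pair_iff {Ω G : Type*} [Group G] [MulAction G Ω] (p : Ω × Ω) (g : G)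
    (x y : Ω) : (g • x, g • y) ∈ MulAction.orbit G p ↔ (x, y) ∈ MulAction.orbit G p := by
  rw [MulAction.mem_orbit_symm, MulAction.mem_orbit_symm (a₁ := (x, y)), ← Prod.smul_mk,
    MulAction.orbit_smul]

/-- The adjacency algebra is the centraliser algebra of the permutation representation, so
membership reduces to checking invariance. -/
theorem mem_orbitals_invariant {M : Matrix Ω Ω ℂ} :
    M ∈ adjacencyAlgebra (orbitals G Ω) ↔ ∀ (g : G) (x y : Ω), M (g • x) (g • y) = M x y := by
  constructor
  · intro hM
    induction hM using Algebra.adjoin_induction with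
    | mem a ha =>
      obtain ⟨_, ⟨p, rfl⟩, rfl⟩ := ha
      intro g x y
      classical
      simp only [adjMatrix, Set.indicator, Matrix.of_apply, smul_mem_orbit_pair_iff]
    | algebraMap r => simp [Matrix.algebraMap_matrix_apply]
    | add a b _ _ ha hb => intro g x y; simp [ha, hb]
    | mul a b _ _ ha hb =>
      intro g x y
      rw [Matrix.mul_apply, Matrix.mul_apply, ← Equiv.sum_comp (MulAction.toPerm g)]
      simp [ha, hb]
  · intro h
    refine mem_adjacencyAlgebra_of_const isPartition_orbitals ?_
    rintro _ ⟨r, rfl⟩ _ ⟨g, rfl⟩ _ ⟨k, rfl⟩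
    simp [h]

theorem transpose_mem_orbitals {M : Matrix Ω Ω ℂ} (hM : M ∈ adjacencyAlgebra (orbitals G Ω)) :
    Mᵀ ∈ adjacencyAlgebra (orbitals G Ω) := by
  rw [mem_orbitals_invariant] at hM ⊢
  exact fun g x y => hM g y x

theorem symmetrisation_le_orbitals :
    adjacencyAlgebra (symmetrisation (orbitals G Ω)) ≤ adjacencyAlgebra (orbitals G Ω) := by
  refine Algebra.adjoin_le ?_
  rintro _ ⟨_, ⟨_, ⟨p, rfl⟩, rfl⟩, rfl⟩
  rw [SetLike.mem_coe, mem_orbitals_invariant]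
  intro g x y
  classical
  have h : (g • x, g • y) ∈ MulAction.orbit G p ∪ converse (MulAction.orbit G p) ↔
      (x, y) ∈ MulAction.orbit G p ∪ converse (MulAction.orbit G p) :=
    or_congr (smul_mem_orbit_pair_iff p g x y) (smul_mem_orbit_pair_iff p g y x)
  simp only [adjMatrix, Set.indicator, Matrix.of_apply, h]

/-- Invariance makes `M` constant on each orbital and symmetry extends this to the converse.
Stratifiability enters only through the merged relations forming a partition. -/
theorem mem_symmetrisation_orbitals (h : IsStratifiable (orbitals G Ω)) {M : Matrix Ω Ω ℂ}
    (hM : M ∈ adjacencyAlgebra (orbitals G Ω)) (hsymm : Mᵀ = M) :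
    M ∈ adjacencyAlgebra (symmetrisation (orbitals G Ω)) := by
  rw [mem_orbitals_invariant] at hM
  refine mem_adjacencyAlgebra_of_const h.1.isPartition ?_
  have hs (x y : Ω) : M x y = M y x := by conv_lhs => rw [← hsymm, Matrix.transpose_apply]
  rintro _ ⟨_, ⟨r, rfl⟩, rfl⟩
  have key : ∀ p ∈ MulAction.orbit G r ∪ converse (MulAction.orbit G r),
      M p.1 p.2 = M r.1 r.2 := by
    rintro ⟨x, y⟩ (⟨g, hg⟩ | ⟨g, hg⟩)
    · simp only [Prod.ext_iff, Prod.smul_fst, Prod.smul_snd] at hg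
      simp [← hg.1, ← hg.2, hM]
    · simp only [Prod.ext_iff, Prod.smul_fst, Prod.smul_snd] at hg
      rw [hs]
      simp [← hg.1, ← hg.2, hM]
  exact fun p hp q hq => (key p hp).trans (key q hq).symm

end Orbitals

/-! ### The principal idempotent -/

section Principal

variable {Ω : Type*} [Fintype Ω]

theorem transpose_principalIdempotent : (principalIdempotent Ω)ᵀ = principalIdempotent Ω := rfl

theorem principalIdempotent_mul_mul (M : Matrix Ω Ω ℂ) :
    ∃ c : ℂ, principalIdempotent Ω * M * principalIdempotent Ω = c • principalIdempotent Ω := by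
  refine ⟨∑ y, ∑ x, (Fintype.card Ω : ℂ)⁻¹ * M x y, ?_⟩
  ext a b
  simp [principalIdempotent, Matrix.mul_apply, Finset.sum_mul]

theorem principalIdempotent_mul_self [Nonempty Ω] :
    principalIdempotent Ω * principalIdempotent Ω = principalIdempotent Ω := by
  ext a b
  simp [principalIdempotent, Matrix.mul_apply]

theorem const_vecMul_eq_zero [Nonempty Ω] {M : Matrix Ω Ω ℂ} (h : principalIdempotent Ω * M = 0)
    (k : ℂ) : (fun _ => k) ᵥ* M = 0 := by
  ext y
  have := congrFun (congrFun h (Classical.arbitrary Ω)) y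
  simp only [principalIdempotent, Matrix.mul_apply, Matrix.of_apply, Matrix.zero_apply,
    ← Finset.mul_sum, mul_eq_zero, inv_eq_zero, Nat.cast_eq_zero, Fintype.card_ne_zero,
    false_or] at this
  simp [Matrix.vecMul, dotProduct, ← Finset.mul_sum, this]

/-- An idempotent fixed on both sides by the principal idempotent is zero or principal. -/
theorem eq_zero_or_eq_principalIdempotent [Nonempty Ω] {M : Matrix Ω Ω ℂ}
    (hM : M * M = M) (hr : M * principalIdempotent Ω = M) (hl : principalIdempotent Ω * M = M) :
    M = 0 ∨ M = principalIdempotent Ω := by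
  obtain ⟨c, hc⟩ := principalIdempotent_mul_mul M
  rw [hl, hr] at hc
  have h : M = c • M := by
    conv_lhs => rw [← hM]
    nth_rewrite 1 [hc]
    rw [Matrix.smul_mul, hl]
  by_cases h0 : M = 0
  · exact Or.inl h0
  · right
    have h1 : (1 - c) • M = 0 := by rw [sub_smul, one_smul, ← h, sub_self]
    have hc1 : c = 1 := ((sub_eq_zero.mp ((smul_eq_zero.mp h1).resolve_right h0))).symm
    rw [hc, hc1, one_smul]

end Principal

/-! ### Hermitian elements act as scalars on primitive idempotents -/

section Spectral

variable {Ω : Type*} [Fintype Ω] [DecidableEq Ω]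

theorem aeval_eq_zero_of_isHermitian {N : Matrix Ω Ω ℂ} (hN : N.IsHermitian)
    {q : Polynomial ℝ} (hq : ∀ r ∈ spectrum ℝ N, q.eval r = 0) : Polynomial.aeval N q = 0 := by
  have hN' : IsSelfAdjoint N := hN
  rw [← cfc_polynomial q N hN', cfc_congr (g := fun _ => 0) fun r hr => hq r hr, cfc_const_zero]

/-- In a commutative algebra of matrices, multiplication by a Hermitian element acts on a primitive
idempotent as a scalar. -/
theorem mul_eq_smul_of_isCentralPrimitiveIdempotent {B : Subalgebra ℂ (Matrix Ω Ω ℂ)}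
    (hB : ∀ a b : B, a * b = b * a) {e : B} (he : IsCentralPrimitiveIdempotent e) {N : B}
    (hN : (N : Matrix Ω Ω ℂ).IsHermitian) : ∃ c : ℂ, N * e = c • e := by
  classical
  have hfin : (spectrum ℝ (N : Matrix Ω Ω ℂ)).Finite := Matrix.finite_real_spectrum
  set s := hfin.toFinset with hs
  have hzero : ∀ q : Polynomial ℝ, (∀ r ∈ s, q.eval r = 0) → Polynomial.aeval N q = 0 := by
    intro q hq
    apply Subtype.ext
    have : ((Polynomial.aeval N q : B) : Matrix Ω Ω ℂ) =
        Polynomial.aeval (N : Matrix Ω Ω ℂ) q :=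
      (Polynomial.aeval_algHom_apply (B.val.restrictScalars ℝ) N q).symm
    rw [this]
    exact aeval_eq_zero_of_isHermitian hN fun r hr => hq r (by simpa [hs] using hr)
  -- Lagrange interpolation on the spectrum gives the spectral projections as polynomials in `N`,
  -- which keeps them inside `B`.
  set F : ℝ → B := fun r => Polynomial.aeval N (Lagrange.basis s id r)
  have hbasis : ∀ r ∈ s, ∀ t ∈ s,
      (Lagrange.basis s id r).eval t = if r = t then 1 else 0 := by
    intro r hr t ht
    split_ifs with h
    · subst h
      exact Lagrange.eval_basis_self (v := id) Function.injective_id.injOn hr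
    · exact Lagrange.eval_basis_of_ne (v := id) h ht
  have hsum : ∑ r ∈ s, F r = 1 := by
    have := hzero (∑ r ∈ s, Lagrange.basis s id r - 1) (by
      intro t ht
      rw [Polynomial.eval_sub, Polynomial.eval_finsetSum,
        Finset.sum_congr rfl fun r hr => hbasis r hr t ht]
      simp [ht])
    rw [map_sub, map_sum, map_one, sub_eq_zero] at this
    exact this
  have hidem : ∀ r ∈ s, F r * F r = F r := by
    intro r hr
    have := hzero (Lagrange.basis s id r * Lagrange.basis s id r - Lagrange.basis s id r) (by
      intro t ht
      rw [Polynomial.eval_sub, Polynomial.eval_mul, hbasis r hr t ht]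
      split_ifs <;> simp)
    rw [map_sub, map_mul, sub_eq_zero] at this
    exact this
  have heig : ∀ r ∈ s, N * F r = (r : ℂ) • F r := by
    intro r hr
    have := hzero ((Polynomial.X - Polynomial.C r) * Lagrange.basis s id r) (by
      intro t ht
      rw [Polynomial.eval_mul, hbasis r hr t ht]
      split_ifs with h <;> simp [h])
    rw [map_mul, map_sub, Polynomial.aeval_X, Polynomial.aeval_C, sub_mul, sub_eq_zero] at this
    rw [this, Algebra.algebraMap_eq_smul_one, smul_mul_assoc, one_mul]
    exact (Complex.coe_smul r _).symm
  -- The projections sum to 1, so one does not kill `e`; primitivity then forces `F r * e = e`, and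
  -- `r` is the scalar.
  have hex : ∃ r ∈ s, F r * e ≠ 0 := by
    by_contra! hcon
    apply he.ne_zero
    rw [← one_mul e, ← hsum, Finset.sum_mul]
    exact Finset.sum_eq_zero hcon
  obtain ⟨r, hr, hne⟩ := hex
  have hee : e * e = e := he.isIdempotentElem
  have hFe : F r * e = e := by
    refine (he.primitive (F r * e) ?_ ?_ ?_).resolve_left hne
    · change F r * e * (F r * e) = F r * e
      rw [mul_assoc, ← mul_assoc e, hB e, mul_assoc, hee, ← mul_assoc, hidem r hr]
    · exact Subring.mem_center_iff.mpr fun a => hB a _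
    · rw [mul_assoc, hee]
  refine ⟨r, ?_⟩
  conv_lhs => rw [← hFe, ← mul_assoc, heig r hr, smul_mul_assoc, hFe]

end Spectral

/-! ### The averaged Gram matrix -/

section Averaging

variable {Ω G : Type*} [Group G] [Fintype G] [MulAction G Ω]

/-- The sum over `g` of the rank-one matrices `(v^g)* v^g`. -/
noncomputable def orbitGram (G : Type*) [Group G] [Fintype G] [MulAction G Ω] (v : Ω → ℂ) :
    Matrix Ω Ω ℂ :=
  ∑ g : G, Matrix.vecMulVec (star (permute v g)) (permute v g)

theorem orbitGram_apply (v : Ω → ℂ) (x y : Ω) :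
    orbitGram G v x y = ∑ g : G, star (v (g⁻¹ • x)) * v (g⁻¹ • y) := by
  simp [orbitGram, Matrix.sum_apply, Matrix.vecMulVec_apply, permute]

theorem orbitGram_isHermitian (v : Ω → ℂ) : (orbitGram G v).IsHermitian := by
  ext x y
  simp [orbitGram_apply, mul_comm]

theorem orbitGram_invariant (v : Ω → ℂ) (h : G) (x y : Ω) :
    orbitGram G v (h • x) (h • y) = orbitGram G v x y := by
  rw [orbitGram_apply, orbitGram_apply, ← Equiv.sum_comp (Equiv.mulLeft h)]
  simp [mul_smul]

theorem transpose_orbitGram {v : Ω → ℂ} (hv : ∀ x, (v x).im = 0) :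
    (orbitGram G v)ᵀ = orbitGram G v := by
  have hs (x : Ω) : (starRingEnd ℂ) (v x) = v x := Complex.conj_eq_iff_im.mpr (hv x)
  ext x y
  simp [orbitGram_apply, hs, mul_comm]

variable [Fintype Ω]

theorem vecMul_orbitGram [MulAction.IsPretransitive G Ω] {u v : Ω → ℂ}
    (huv : ∀ g : G, u ⬝ᵥ star (permute v g) = u ⬝ᵥ star v) :
    ∃ k : ℂ, u ᵥ* orbitGram G v = fun _ => k := by
  have h (y : Ω) : (u ᵥ* orbitGram G v) y = (u ⬝ᵥ star v) * ∑ g : G, v (g⁻¹ • y) := by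
    simp [orbitGram, Matrix.vecMul_sum, Matrix.vecMul_vecMulVec, huv, Finset.mul_sum, permute]
  have hconst (x y : Ω) : (u ᵥ* orbitGram G v) x = (u ᵥ* orbitGram G v) y := by
    obtain ⟨k, rfl⟩ := MulAction.exists_smul_eq G y x
    rw [h, h, ← Equiv.sum_comp (Equiv.mulLeft k)]
    simp [mul_smul]
  cases isEmpty_or_nonempty Ω with
  | inl _ => exact ⟨0, Subsingleton.elim _ _⟩
  | inr hne => exact ⟨_, funext fun x => hconst x hne.some⟩

/-- Each rank-one summand has trace `v^g M (v^g)*`, which invariance of `M` makes independent of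
`g`. -/
theorem trace_orbitGram_mul {v : Ω → ℂ} {M : Matrix Ω Ω ℂ}
    (hM : ∀ (g : G) (x y : Ω), M (g • x) (g • y) = M x y) :
    (orbitGram G v * M).trace = Fintype.card G * quadForm M v := by
  have h1 (g : G) : (Matrix.vecMulVec (star (permute v g)) (permute v g) * M).trace =
      quadForm M (permute v g) := by
    rw [Matrix.vecMulVec_mul, Matrix.trace_vecMulVec, dotProduct_comm, quadForm]
  have h2 (g : G) : quadForm M (permute v g) = quadForm M v := by
    simp only [quadForm, dotProduct, Matrix.vecMul]
    rw [← Equiv.sum_comp (MulAction.toPerm g)]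
    refine Finset.sum_congr rfl fun y _ => ?_
    rw [← Equiv.sum_comp (MulAction.toPerm g)]
    simp [permute, hM]
  simp [orbitGram, Finset.sum_mul, Matrix.trace_sum, h1, h2]

end Averaging

/-! ### Elements of the orbital algebra -/

section Membership

variable {Ω G : Type*} [Fintype Ω] [DecidableEq Ω] [Group G] [MulAction G Ω]

theorem principalIdempotent_mem_orbitals :
    principalIdempotent Ω ∈ adjacencyAlgebra (orbitals G Ω) :=
  mem_orbitals_invariant.mpr fun _ _ _ => rfl

theorem orbitGram_mem_orbitals [Fintype G] (v : Ω → ℂ) :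
    orbitGram G v ∈ adjacencyAlgebra (orbitals G Ω) :=
  mem_orbitals_invariant.mpr (orbitGram_invariant v)

end Membership

/-! ### Passing between the full and symmetrised algebras -/

section Stratifiable

/-- The commutator of `D` with the idempotent `F` is purely off-diagonal in the Peirce decomposition
of `F`, so it vanishes once it commutes with `F`. -/
theorem mul_comm_of_mul_sub_mul_comm {A : Type*} [Ring A] {F D : A} (hF : F * F = F)
    (h : F * (F * D - D * F) = (F * D - D * F) * F) : F * D = D * F := by
  have h' : F * D - F * D * F = F * D * F - D * F := by
    rw [mul_sub, sub_mul, ← mul_assoc, hF, mul_assoc D, hF, ← mul_assoc] at h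
    exact h
  have hl : F * D = F * D * F := by
    have := congrArg (F * ·) h'
    simp only [mul_sub, ← mul_assoc, hF, sub_self] at this
    exact sub_eq_zero.mp this
  rw [← hl, sub_self] at h'
  exact sub_eq_zero.mp h'.symm

variable {Ω G : Type*} [Fintype Ω] [DecidableEq Ω] [Group G] [MulAction G Ω]

/-- Idempotents of the adjacency algebra of the symmetrisation of a stratifiable configuration are
central in the full adjacency algebra. -/
theorem mul_comm_of_isStratifiable (h : IsStratifiable (orbitals G Ω)) {F M : Matrix Ω Ω ℂ}
    (hF : F ∈ adjacencyAlgebra (symmetrisation (orbitals G Ω))) (hFF : F * F = F)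
    (hM : M ∈ adjacencyAlgebra (orbitals G Ω)) : F * M = M * F := by
  have hFt : Fᵀ = F := transpose_eq_of_mem_symmetrisation h.2 hF
  have hFA := symmetrisation_le_orbitals hF
  have hMt := transpose_mem_orbitals hM
  have hplus : F * (M + Mᵀ) = (M + Mᵀ) * F :=
    mul_comm_of_mem_adjacencyAlgebra h.2 hF <| mem_symmetrisation_orbitals h
      (add_mem hM hMt) (by rw [Matrix.transpose_add, Matrix.transpose_transpose, add_comm])
  have hDA : M - Mᵀ ∈ adjacencyAlgebra (orbitals G Ω) := sub_mem hM hMt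
  -- `F` is symmetric and `D = M - Mᵀ` antisymmetric, so `F D - D F` is symmetric. It therefore lies
  -- in the commutative symmetrised algebra and commutes with `F`.
  have hminus : F * (M - Mᵀ) = (M - Mᵀ) * F :=
    mul_comm_of_mul_sub_mul_comm hFF <| mul_comm_of_mem_adjacencyAlgebra h.2 hF <|
      mem_symmetrisation_orbitals h (sub_mem (mul_mem hFA hDA) (mul_mem hDA hFA)) (by
        simp only [Matrix.transpose_sub, Matrix.transpose_mul, hFt, Matrix.transpose_transpose]
        noncomm_ring)
  have h2 : (2 : ℂ) • (F * M) = (2 : ℂ) • (M * F) := by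
    calc (2 : ℂ) • (F * M) = F * (M + Mᵀ) + F * (M - Mᵀ) := by rw [two_smul]; noncomm_ring
      _ = (M + Mᵀ) * F + (M - Mᵀ) * F := by rw [hplus, hminus]
      _ = (2 : ℂ) • (M * F) := by rw [two_smul]; noncomm_ring
  exact smul_right_injective _ two_ne_zero h2

/-- If `S` is built from a central primitive idempotent `e` so that it absorbs idempotents of the
symmetrisation as `e` does, then `S` is a central primitive idempotent of the symmetrisation. -/
theorem isCentralPrimitiveIdempotent_symmetrisation (h : IsStratifiable (orbitals G Ω))
    {e : adjacencyAlgebra (orbitals G Ω)} (he : IsCentralPrimitiveIdempotent e)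
    {S : adjacencyAlgebra (symmetrisation (orbitals G Ω))} (hSS : S * S = S) (hS0 : S ≠ 0)
    (h0 : ∀ F : adjacencyAlgebra (symmetrisation (orbitals G Ω)),
      (e : Matrix Ω Ω ℂ) * F = 0 → (S : Matrix Ω Ω ℂ) * F = 0)
    (h1 : ∀ F : adjacencyAlgebra (symmetrisation (orbitals G Ω)),
      (e : Matrix Ω Ω ℂ) * F = e → (S : Matrix Ω Ω ℂ) * F = S) :
    IsCentralPrimitiveIdempotent S := by
  have hcomm (a b : adjacencyAlgebra (symmetrisation (orbitals G Ω))) : a * b = b * a :=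
    Subtype.ext (mul_comm_of_mem_adjacencyAlgebra h.2 a.2 b.2)
  refine ⟨hSS, Subring.mem_center_iff.mpr fun a => hcomm a S, hS0, fun F hFF _ hFS => ?_⟩
  have hFF' : (F : Matrix Ω Ω ℂ) * F = F := congrArg Subtype.val (show F * F = F from hFF)
  have hee : e * e = e := he.isIdempotentElem
  set F' : adjacencyAlgebra (orbitals G Ω) := ⟨F, symmetrisation_le_orbitals F.2⟩
  -- Centrality of `F` in the full algebra makes `e * F'` a central idempotent below `e`, so
  -- primitivity of `e` applies.
  have hF'c (M : adjacencyAlgebra (orbitals G Ω)) : M * F' = F' * M :=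
    Subtype.ext (mul_comm_of_isStratifiable h F.2 hFF' M.2).symm
  have hF'F' : F' * F' = F' := Subtype.ext hFF'
  have hid : e * F' * (e * F') = e * F' := by
    rw [mul_assoc, ← mul_assoc F', ← hF'c e, mul_assoc e F', hF'F', ← mul_assoc, hee]
  have hcen : e * F' ∈ Subring.center (adjacencyAlgebra (orbitals G Ω)) :=
    mul_mem he.mem_center (Subring.mem_center_iff.mpr hF'c)
  have habs : e * F' * e = e * F' := by rw [mul_assoc, ← hF'c e, ← mul_assoc, hee]
  rw [hcomm] at hFS
  rcases he.primitive (e * F') hid hcen habs with hz | ho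
  · left
    rw [← hFS]
    exact Subtype.ext (h0 F (congrArg Subtype.val hz))
  · right
    rw [← hFS]
    exact Subtype.ext (h1 F (congrArg Subtype.val ho))

theorem quadForm_transpose_of_real {Ω : Type*} [Fintype Ω] {w : Ω → ℂ} (hw : ∀ x, (w x).im = 0) (M : Matrix Ω Ω ℂ) :
    quadForm Mᵀ w = quadForm M w := by
  have hs : star w = w := funext fun x => Complex.conj_eq_iff_im.mpr (hw x)
  rw [quadForm, quadForm, hs, Matrix.vecMul_transpose, dotProduct_comm,
    Matrix.dotProduct_mulVec]

/-- A central primitive idempotent that is not symmetric is orthogonal to its transpose. -/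
theorem mul_transpose_eq_zero {e : adjacencyAlgebra (orbitals G Ω)}
    (he : IsCentralPrimitiveIdempotent e) (hsymm : (e : Matrix Ω Ω ℂ)ᵀ ≠ e) :
    (e : Matrix Ω Ω ℂ) * (e : Matrix Ω Ω ℂ)ᵀ = 0 := by
  have hee : e * e = e := he.isIdempotentElem
  have hec := Subring.mem_center_iff.mp he.mem_center
  set t : adjacencyAlgebra (orbitals G Ω) := ⟨(e : Matrix Ω Ω ℂ)ᵀ, transpose_mem_orbitals e.2⟩
  have htt : t * t = t := Subtype.ext <| by
    have := congrArg (fun a : adjacencyAlgebra (orbitals G Ω) => (a : Matrix Ω Ω ℂ)ᵀ) hee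
    simpa [Matrix.transpose_mul] using this
  have htc (M : adjacencyAlgebra (orbitals G Ω)) : M * t = t * M := Subtype.ext <| by
    have := congrArg (fun a : adjacencyAlgebra (orbitals G Ω) => (a : Matrix Ω Ω ℂ)ᵀ)
      (hec ⟨(M : Matrix Ω Ω ℂ)ᵀ, transpose_mem_orbitals M.2⟩)
    simpa [Matrix.transpose_mul] using this.symm
  have hid : e * t * (e * t) = e * t := by
    rw [mul_assoc, ← mul_assoc t, ← htc e, mul_assoc e t, htt, ← mul_assoc, hee]
  have habs : e * t * e = e * t := by rw [mul_assoc, ← htc e, ← mul_assoc, hee]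
  rcases he.primitive (e * t) hid
    (mul_mem he.mem_center (Subring.mem_center_iff.mpr htc)) habs with hz | ho
  · exact congrArg Subtype.val hz
  · refine absurd ?_ hsymm
    have ho' : (e : Matrix Ω Ω ℂ) * (e : Matrix Ω Ω ℂ)ᵀ = e := congrArg Subtype.val ho
    conv_lhs => rw [← ho', Matrix.transpose_mul, Matrix.transpose_transpose, ho']

end Stratifiable

/-! ### Design-orthogonality -/

section Main

variable {Ω G : Type*} [Fintype Ω] [DecidableEq Ω] [Nonempty Ω] [Group G] [MulAction G Ω]

theorem quadForm_mul_quadForm_eq_zero [Fintype G] [MulAction.IsPretransitive G Ω] {u v : Ω → ℂ}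
    (huv : ∀ g : G, u ⬝ᵥ star (permute v g) = u ⬝ᵥ star v)
    {B : Subalgebra ℂ (Matrix Ω Ω ℂ)} (hB : ∀ a b : B, a * b = b * a)
    (hinv : B ≤ adjacencyAlgebra (orbitals G Ω))
    (hP : principalIdempotent Ω ∈ B) (hN : orbitGram G v ∈ B)
    {e : B} (he : IsCentralPrimitiveIdempotent e)
    (hne : (e : Matrix Ω Ω ℂ) ≠ principalIdempotent Ω) :
    quadForm (e : Matrix Ω Ω ℂ) u * quadForm (e : Matrix Ω Ω ℂ) v = 0 := by
  have hee : e * e = e := he.isIdempotentElem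
  set P : B := ⟨principalIdempotent Ω, hP⟩
  have hPP : P * P = P := Subtype.ext principalIdempotent_mul_self
  -- By primitivity `P * e` is `0` or `e`; the latter would force `e` to be zero or principal.
  have hPe : P * e = 0 := by
    refine (he.primitive (P * e) ?_ ?_ ?_).resolve_right fun h => ?_
    · change P * e * (P * e) = P * e
      rw [mul_assoc, ← mul_assoc e, hB e, mul_assoc, hee, ← mul_assoc, hPP]
    · exact Subring.mem_center_iff.mpr fun a => hB a _
    · rw [mul_assoc, hee]
    · rcases eq_zero_or_eq_principalIdempotent (congrArg Subtype.val hee)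
        (congrArg Subtype.val ((hB e P).trans h)) (congrArg Subtype.val h) with h0 | h1
      · exact he.ne_zero (Subtype.ext h0)
      · exact hne h1
  obtain ⟨c, hc⟩ := mul_eq_smul_of_isCentralPrimitiveIdempotent hB he
    (N := ⟨orbitGram G v, hN⟩) (orbitGram_isHermitian v)
  have hc' : orbitGram G v * (e : Matrix Ω Ω ℂ) = c • (e : Matrix Ω Ω ℂ) :=
    congrArg Subtype.val hc
  obtain ⟨k, hk⟩ := vecMul_orbitGram huv
  have h0 : c • (u ᵥ* (e : Matrix Ω Ω ℂ)) = 0 := by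
    rw [← Matrix.vecMul_smul, ← hc', ← Matrix.vecMul_vecMul, hk]
    exact const_vecMul_eq_zero (congrArg Subtype.val hPe) k
  rcases smul_eq_zero.mp h0 with rfl | h
  · have ht := trace_orbitGram_mul (v := v) (mem_orbitals_invariant.mp (hinv e.2))
    rw [hc', zero_smul, Matrix.trace_zero, zero_eq_mul] at ht
    rw [ht.resolve_left (by simp), mul_zero]
  · simp [quadForm, h]

theorem designOrthogonal_orbitals_of_isCommutative [Finite G] [MulAction.IsPretransitive G Ω]
    {u v : Ω → ℂ} (huv : ∀ g : G, u ⬝ᵥ star (permute v g) = u ⬝ᵥ star v)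
    (h : IsCommutative (orbitals G Ω)) : DesignOrthogonal (orbitals G Ω) u v := by
  have := Fintype.ofFinite G
  exact fun e he hne => quadForm_mul_quadForm_eq_zero huv
    (fun a b => Subtype.ext (mul_comm_of_mem_adjacencyAlgebra h a.2 b.2)) le_rfl
    principalIdempotent_mem_orbitals (orbitGram_mem_orbitals v) he hne

theorem designOrthogonal_symmetrisation [Finite G] [MulAction.IsPretransitive G Ω]
    {u v : Ω → ℂ} (huv : ∀ g : G, u ⬝ᵥ star (permute v g) = u ⬝ᵥ star v)
    (h : IsStratifiable (orbitals G Ω)) (hv : ∀ x, (v x).im = 0) :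
    DesignOrthogonal (symmetrisation (orbitals G Ω)) u v := by
  have := Fintype.ofFinite G
  exact fun e he hne => quadForm_mul_quadForm_eq_zero huv
    (fun a b => Subtype.ext (mul_comm_of_mem_adjacencyAlgebra h.2 a.2 b.2))
    symmetrisation_le_orbitals
    (mem_symmetrisation_orbitals h principalIdempotent_mem_orbitals transpose_principalIdempotent)
    (mem_symmetrisation_orbitals h (orbitGram_mem_orbitals v) (transpose_orbitGram hv)) he hne

theorem designOrthogonal_orbitals_of_isStratifiable {u v : Ω → ℂ}
    (h : IsStratifiable (orbitals G Ω)) (hu : ∀ x, (u x).im = 0) (hv : ∀ x, (v x).im = 0)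
    (hsym : DesignOrthogonal (symmetrisation (orbitals G Ω)) u v) :
    DesignOrthogonal (orbitals G Ω) u v := by
  intro e he hne
  obtain ⟨E, hE⟩ : ∃ E : Matrix Ω Ω ℂ, E = e := ⟨_, rfl⟩
  have hEA : E ∈ adjacencyAlgebra (orbitals G Ω) := hE ▸ e.2
  have hee : e * e = e := he.isIdempotentElem
  have hEE : E * E = E := by rw [hE]; exact congrArg Subtype.val hee
  have hE0 : E ≠ 0 := fun h0 => he.ne_zero (Subtype.ext (hE ▸ h0))
  by_cases hsymm : Eᵀ = E
  · have hES := mem_symmetrisation_orbitals h hEA hsymm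
    have hS : IsCentralPrimitiveIdempotent
        (⟨E, hES⟩ : adjacencyAlgebra (symmetrisation (orbitals G Ω))) :=
      isCentralPrimitiveIdempotent_symmetrisation h he (Subtype.ext hEE)
        (fun h0 => hE0 (congrArg Subtype.val h0)) (fun F hF => by rwa [← hE] at hF)
        (fun F hF => by rwa [← hE] at hF)
    rw [← hE] at hne ⊢
    exact hsym ⟨E, hES⟩ hS hne
  · have hET : E * Eᵀ = 0 := by
      rw [hE] at hsymm ⊢
      exact mul_transpose_eq_zero he hsymm
    have hcomm : Eᵀ * E = E * Eᵀ := by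
      rw [hE]
      exact congrArg Subtype.val
        (Subring.mem_center_iff.mp he.mem_center ⟨_, transpose_mem_orbitals e.2⟩)
    have hTE : Eᵀ * E = 0 := hcomm.trans hET
    have hTT : Eᵀ * Eᵀ = Eᵀ := by rw [← Matrix.transpose_mul, hEE]
    have hSS : (E + Eᵀ) * (E + Eᵀ) = E + Eᵀ := by
      rw [mul_add, add_mul, add_mul, hEE, hET, hTE, hTT, add_zero, zero_add]
    have hmem : E + Eᵀ ∈ adjacencyAlgebra (symmetrisation (orbitals G Ω)) :=
      mem_symmetrisation_orbitals h (add_mem hEA (transpose_mem_orbitals hEA))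
        (by rw [Matrix.transpose_add, Matrix.transpose_transpose, add_comm])
    have hES : E * (E + Eᵀ) = E := by rw [mul_add, hEE, hET, add_zero]
    have hSE : (E + Eᵀ) * E = E := by rw [add_mul, hEE, hTE, add_zero]
    -- Transfers `E * F = 0` or `E * F = E` to `Eᵀ`, as needed for the primitivity of `E + Eᵀ`.
    have hcF (F : adjacencyAlgebra (symmetrisation (orbitals G Ω))) :
        Eᵀ * F = (E * (F : Matrix Ω Ω ℂ))ᵀ := by
      have hFt : (F : Matrix Ω Ω ℂ)ᵀ = F := transpose_eq_of_mem_symmetrisation h.2 F.2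
      have hEF : E * (F : Matrix Ω Ω ℂ) = F * E := by
        rw [hE]
        exact congrArg Subtype.val (Subring.mem_center_iff.mp he.mem_center
          ⟨F, symmetrisation_le_orbitals F.2⟩).symm
      rw [hEF, Matrix.transpose_mul, hFt]
    have hS : IsCentralPrimitiveIdempotent
        (⟨E + Eᵀ, hmem⟩ : adjacencyAlgebra (symmetrisation (orbitals G Ω))) := by
      refine isCentralPrimitiveIdempotent_symmetrisation h he (Subtype.ext hSS) ?_ ?_ ?_
      · intro h0
        have h0' : E + Eᵀ = 0 := congrArg Subtype.val h0
        exact hE0 (by rw [← hES, h0', mul_zero])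
      · intro F hF
        rw [← hE] at hF
        rw [add_mul, hcF, hF, Matrix.transpose_zero, add_zero]
      · intro F hF
        rw [← hE] at hF
        rw [add_mul, hcF, hF]
    -- `E + Eᵀ` fixes `E` on both sides; were it principal, `E` would be zero or principal.
    have hSP : E + Eᵀ ≠ principalIdempotent Ω := by
      intro hP
      rw [hP] at hES hSE
      rcases eq_zero_or_eq_principalIdempotent hEE hES hSE with h0 | h1
      · exact hE0 h0
      · exact hne (hE ▸ h1)
    have hq {w : Ω → ℂ} (hw : ∀ x, (w x).im = 0) :
        quadForm (E + Eᵀ) w = 2 * quadForm E w := by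
      have hadd : quadForm (E + Eᵀ) w = quadForm E w + quadForm Eᵀ w := by
        rw [quadForm, Matrix.vecMul_add, add_dotProduct]
        rfl
      rw [hadd, quadForm_transpose_of_real hw, two_mul]
    have key : quadForm (E + Eᵀ) u * quadForm (E + Eᵀ) v = 0 :=
      hsym ⟨E + Eᵀ, hmem⟩ hS hSP
    rw [hq hu, hq hv] at key
    rw [← hE]
    simpa using key

end Main

end CoherentConfig

theorem mainTheorem5 {Ω : Type*} [Fintype Ω] [DecidableEq Ω] [Nonempty Ω]
    (G : Subgroup (Equiv.Perm Ω)) [MulAction.IsPretransitive G Ω] (u v : Ω → ℂ)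
    (huv : ∀ g : G, u ⬝ᵥ star (CoherentConfig.permute v g) = u ⬝ᵥ star v) :
    (CoherentConfig.IsCommutative (CoherentConfig.orbitals G Ω) →
      CoherentConfig.DesignOrthogonal (CoherentConfig.orbitals G Ω) u v) ∧
    (CoherentConfig.IsStratifiable (CoherentConfig.orbitals G Ω) →
      (∀ x, (u x).im = 0) → (∀ x, (v x).im = 0) →
      CoherentConfig.DesignOrthogonal (CoherentConfig.orbitals G Ω) u v ∧
      CoherentConfig.DesignOrthogonal
        (CoherentConfig.symmetrisation (CoherentConfig.orbitals G Ω)) u v) := by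
  refine ⟨CoherentConfig.designOrthogonal_orbitals_of_isCommutative huv, fun h hu hv => ?_⟩
  have hsym := CoherentConfig.designOrthogonal_symmetrisation huv h hv
  exact ⟨CoherentConfig.designOrthogonal_orbitals_of_isStratifiable h hu hv hsym, hsym⟩
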